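/- **Theorem 2.1 (Pieri formula in the algebra $\mathcal{E}_n\langle R\rangle[t]$).** For an integer $n\ge 0$ let $\mathcal{E}_n\langle R\rangle[t]$ be the associative unital ring generated by the symbols $[i,j]$ ($1\le i,j\le n$, $i\ne j$), $x_1,\dots,x_n$ and $t$, subject to the following relations. * Relations of the Fomin–Kirillov algebra $\mathcal{E}_n$: $[i,j]=-[j,i]$; $[i,j]^2=0$; $[i,j][k,l]=[k,l][i,j]$ if $\{i,j\}\cap\{k,l\}=\emptyset$; and $[i,j][j,k]+[j,k][k,i]+[k,i][i,j]=0$ for distinct $i,j,k$. * The elements $x_1,\dots,x_n,t$ commute with each other. * $[i,j]x_k=x_k[i,j]$ for $k\ne i,j$; for $i<j$, $[i,j]x_i=x_j[i,j]+t$ and $[i,j]x_j=x_i[i,j]-t$; and $[i,j]t=t[i,j]$. (Thus it is the extension of $\mathcal{E}_n$ by $R[t]=\mathbb{Z}[x_1,\dots,x_n][t]$ defined by the last group of relations.) Define the Dunkl elements $\theta_i=x_i+\sum_{j\neq i}[i,j]$, $1\le i\le n$; they commute pairwise. Let $e_k$ denote the $k$-th elementary symmetric polynomial, with $e_0=1$.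 Then for all integers $0\le k\le m\le n$ one has in $\mathcal{E}_n\langle R\rangle[t]$ $$e_k(\theta_1,\dots,\theta_m)=\sum_{r\ge 0}(-t)^r\,N(m-k,2r)\sum X_S\,[i_1,j_1]\cdots[i_l,j_l],$$ where $$N(a,2b)=(2b-1)!!\binom{a+2b}{2b}\quad\text{(with } (-1)!!=1),\qquad X_S=\prod_{s\in S}x_s,$$ and the inner sum runs over all integers $l\ge 0$, all subsets $S\subset\{1,\dots,m\}$ and all pairs of sequences $(i_1,\dots,i_l)$, $(j_1,\dots,j_l)$ such that $|S|+l+2r=k$, the $i_1,\dots,i_l$ are pairwise distinct elements of $\{1,\dots,m\}\setminus S$ (taken in every order), and $m<j_1\le j_2\le\cdots\le j_l\le n$. -/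

import Mathlib

/-- The generators of `E_n⟨R⟩[t]`: the symbols `[i,j]` with `i ≠ j`, the variables `x_i`, and `t`.
The index set `{1, …, n}` is `Fin n`. -/
inductive FKGen (n : ℕ) : Type
  | br (i j : Fin n) (h : i ≠ j) : FKGen n
  | x (i : Fin n) : FKGen n
  | t : FKGen n

namespace FKGen

/-- The symbol `[i,j]` in the free ring (`0` by convention if `i = j`; no relation below uses
that case). -/
def brF {n : ℕ} (i j : Fin n) : FreeAlgebra ℤ (FKGen n) :=
  if h : i ≠ j then FreeAlgebra.ι ℤ (FKGen.br i j h) else 0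

/-- The symbol `x_i` in the free ring. -/
def xF {n : ℕ} (i : Fin n) : FreeAlgebra ℤ (FKGen n) := FreeAlgebra.ι ℤ (FKGen.x i)

/-- The symbol `t` in the free ring. -/
def tF {n : ℕ} : FreeAlgebra ℤ (FKGen n) := FreeAlgebra.ι ℤ FKGen.t

end FKGen

open FKGen in
/-- The defining relations of `E_n⟨R⟩[t]`. -/
inductive FKRel (n : ℕ) : FreeAlgebra ℤ (FKGen n) → FreeAlgebra ℤ (FKGen n) → Prop
  /- the relations of the Fomin–Kirillov algebra `E_n` -/
  | antisymm (i j : Fin n) (hij : i ≠ j) : FKRel n (brF i j) (-brF j i)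
  | sq (i j : Fin n) (hij : i ≠ j) : FKRel n (brF i j * brF i j) 0
  | comm (i j k l : Fin n) (hij : i ≠ j) (hkl : k ≠ l)
      (hik : i ≠ k) (hil : i ≠ l) (hjk : j ≠ k) (hjl : j ≠ l) :
      FKRel n (brF i j * brF k l) (brF k l * brF i j)
  | three (i j k : Fin n) (hij : i ≠ j) (hjk : j ≠ k) (hki : k ≠ i) :
      FKRel n (brF i j * brF j k + brF j k * brF k i + brF k i * brF i j) 0
  /- the `x_i` and `t` generate a commutative (polynomial) ring -/
  | x_comm (i j : Fin n) : FKRel n (xF i * xF j) (xF j * xF i)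
  | x_t (i : Fin n) : FKRel n (xF i * tF) (tF * xF i)
  /- the commutation relations between the brackets and `R[t]` -/
  | br_x_of_ne (i j k : Fin n) (hij : i ≠ j) (hki : k ≠ i) (hkj : k ≠ j) :
      FKRel n (brF i j * xF k) (xF k * brF i j)
  | br_x_left (i j : Fin n) (hij : i < j) : FKRel n (brF i j * xF i) (xF j * brF i j + tF)
  | br_x_right (i j : Fin n) (hij : i < j) : FKRel n (brF i j * xF j) (xF i * brF i j - tF)
  | br_t (i j : Fin n) (hij : i ≠ j) : FKRel n (brF i j * tF) (tF * brF i j)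

/-- The ring `E_n⟨R⟩[t]`: the extension of the Fomin–Kirillov algebra `E_n` by
`R[t] = ℤ[x_1, …, x_n][t]`. -/
def FKAlg (n : ℕ) : Type := RingQuot (FKRel n)

noncomputable instance FKAlg.instRing (n : ℕ) : Ring (FKAlg n) :=
  inferInstanceAs (Ring (RingQuot (FKRel n)))

namespace FKAlg

variable {n : ℕ}

/-- The quotient map from the free ring. -/
noncomputable def mk : FreeAlgebra ℤ (FKGen n) →+* FKAlg n := RingQuot.mkRingHom (FKRel n)

theorem mk_rel {a b : FreeAlgebra ℤ (FKGen n)} (h : FKRel n a b) : mk a = mk b :=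
  RingQuot.mkRingHom_rel h

/-- The element `[i,j]` (`0` by convention if `i = j`). -/
noncomputable def br (i j : Fin n) : FKAlg n := mk (FKGen.brF i j)

/-- The element `x_i`. -/
noncomputable def x (i : Fin n) : FKAlg n := mk (FKGen.xF i)

/-- The element `t`. -/
noncomputable def t : FKAlg n := mk FKGen.tF

/-- The Dunkl element `θ_i = x_i + ∑_{j ≠ i} [i,j]`. -/
noncomputable def dunkl (i : Fin n) : FKAlg n := x i + ∑ j ∈ Finset.univ.erase i, br i j

theorem x_comm (i j : Fin n) : Commute (x i) (x j) := by
  have h := mk_rel (FKRel.x_comm i j)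
  rw [map_mul, map_mul] at h
  exact h

theorem br_antisymm (i j : Fin n) (hij : i ≠ j) : br i j = -br j i := by
  have h := mk_rel (FKRel.antisymm i j hij)
  simp only [map_neg] at h
  exact h

theorem br_comm (i j k l : Fin n) (hij : i ≠ j) (hkl : k ≠ l)
    (hik : i ≠ k) (hil : i ≠ l) (hjk : j ≠ k) (hjl : j ≠ l) :
    br i j * br k l = br k l * br i j := by
  have h := mk_rel (FKRel.comm i j k l hij hkl hik hil hjk hjl)
  simp only [map_mul] at h
  exact h

theorem br_three (i j k : Fin n) (hij : i ≠ j) (hjk : j ≠ k) (hki : k ≠ i) :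
    br i j * br j k + br j k * br k i + br k i * br i j = 0 := by
  have h := mk_rel (FKRel.three i j k hij hjk hki)
  simp only [map_mul, map_add, map_zero] at h
  exact h

theorem br_x_of_ne (i j k : Fin n) (hij : i ≠ j) (hki : k ≠ i) (hkj : k ≠ j) :
    br i j * x k = x k * br i j := by
  have h := mk_rel (FKRel.br_x_of_ne i j k hij hki hkj)
  simp only [map_mul] at h
  exact h

theorem br_x_left (i j : Fin n) (hij : i < j) : br i j * x i = x j * br i j + t := by
  have h := mk_rel (FKRel.br_x_left i j hij)
  simp only [map_mul, map_add] at h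
  exact h

theorem br_x_right (i j : Fin n) (hij : i < j) : br i j * x j = x i * br i j - t := by
  have h := mk_rel (FKRel.br_x_right i j hij)
  simp only [map_mul, map_sub] at h
  exact h

theorem br_x_add (i j : Fin n) (hij : i ≠ j) :
    br i j * x i + br i j * x j = x i * br i j + x j * br i j := by
  rcases lt_or_gt_of_ne hij with h | h
  · rw [br_x_left i j h, br_x_right i j h]; abel
  · have h1 := br_x_left j i h
    have h2 := br_x_right j i h
    rw [br_antisymm i j hij]
    simp only [neg_mul, mul_neg, h1, h2]
    abel

/-- The Dunkl elements commute pairwise (so that symmetric polynomials can be evaluated at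
them). -/
theorem dunkl_comm (i j : Fin n) : Commute (dunkl i) (dunkl j) := by
  rcases eq_or_ne i j with rfl | hij
  · exact Commute.refl _
  set C : Finset (Fin n) := (Finset.univ.erase i).erase j with hC
  have hmem : ∀ c ∈ C, c ≠ i ∧ c ≠ j := by
    intro c hc
    simp only [hC, Finset.mem_erase, Finset.mem_univ, and_true] at hc
    exact ⟨hc.2, hc.1⟩
  have hi : dunkl i = x i + (br i j + ∑ c ∈ C, br i c) := by
    rw [dunkl, hC, Finset.add_sum_erase _ (fun c => br i c) (by simp [hij.symm])]
  have hj : dunkl j = x j + (-br i j + ∑ c ∈ C, br j c) := by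
    rw [dunkl, hC, Finset.erase_right_comm, ← br_antisymm j i hij.symm,
      Finset.add_sum_erase _ (fun c => br j c) (by simp [hij])]
  set P := ∑ c ∈ C, br i c with hP
  set Q := ∑ c ∈ C, br j c with hQ
  have hxQ : Q * x i = x i * Q := by
    rw [hQ, Finset.sum_mul, Finset.mul_sum]
    exact Finset.sum_congr rfl fun c hc =>
      br_x_of_ne j c i (hmem c hc).2.symm hij (hmem c hc).1.symm
  have hPx : P * x j = x j * P := by
    rw [hP, Finset.sum_mul, Finset.mul_sum]
    exact Finset.sum_congr rfl fun c hc =>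
      br_x_of_ne i c j (hmem c hc).1.symm hij.symm (hmem c hc).2.symm
  have hPQ : br i j * Q - Q * br i j - P * br i j + br i j * P + (P * Q - Q * P) = 0 := by
    have e : P * Q - Q * P = ∑ c ∈ C, (br i c * br j c - br j c * br i c) := by
      rw [hP, hQ, Finset.sum_mul_sum, Finset.sum_mul_sum, Finset.sum_comm,
        ← Finset.sum_sub_distrib]
      refine Finset.sum_congr rfl fun c hc => ?_
      rw [← Finset.sum_sub_distrib]
      refine Finset.sum_eq_single_of_mem c hc fun d hd hdc => ?_
      rw [br_comm i d j c (hmem d hd).1.symm (hmem c hc).2.symm hij (hmem c hc).1.symm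
        (hmem d hd).2 hdc, sub_self]
    rw [e, hP, hQ]
    simp only [Finset.sum_mul, Finset.mul_sum, ← Finset.sum_sub_distrib, ← Finset.sum_add_distrib]
    refine Finset.sum_eq_zero fun c hc => ?_
    obtain ⟨hci, hcj⟩ := hmem c hc
    have h1 := br_three i j c hij hcj.symm hci
    have h2 := br_three j i c hij.symm hci.symm hcj
    rw [br_antisymm c i hci] at h1
    rw [br_antisymm j i hij.symm, br_antisymm c j hcj] at h2
    simp only [neg_mul, mul_neg, neg_neg] at h1 h2
    have : br i j * br j c - br j c * br i j - br i c * br i j + br i j * br i c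
        + (br i c * br j c - br j c * br i c)
        = (br i j * br j c + -(br j c * br i c) + -(br i c * br i j))
          - (-(br i j * br i c) + -(br i c * br j c) + br j c * br i j) := by abel
    rw [this, h1, h2, sub_zero]
  have hB := br_x_add i j hij
  have hX : x i * x j = x j * x i := x_comm i j
  rw [hi, hj, commute_iff_eq, ← sub_eq_zero]
  have key : (x i + (br i j + P)) * (x j + (-br i j + Q)) - (x j + (-br i j + Q)) * (x i + (br i j + P))
      = (x i * x j - x j * x i)
        + ((br i j * x i + br i j * x j) - (x i * br i j + x j * br i j))
        - (Q * x i - x i * Q) + (P * x j - x j * P)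
        + (br i j * Q - Q * br i j - P * br i j + br i j * P + (P * Q - Q * P)) := by
    simp only [mul_add, add_mul, neg_mul, mul_neg]
    abel
  rw [key, hX, hB, hxQ, hPx, hPQ]
  simp

/-- `X_S = ∏_{s ∈ S} x_s` (the `x_s` commute). -/
noncomputable def xProd (S : Finset (Fin n)) : FKAlg n :=
  S.noncommProd x (fun i _ j _ _ => x_comm i j)

/-- `e_k(θ_a : a ∈ A)`: the `k`-th elementary symmetric polynomial in the (pairwise commuting)
Dunkl elements `θ_a`, `a ∈ A`, as the sum over all `k`-element subsets `T` of `A` of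
`∏_{a ∈ T} θ_a`. -/
noncomputable def esymmDunkl (k : ℕ) (A : Finset (Fin n)) : FKAlg n :=
  ∑ T ∈ A.powersetCard k, T.noncommProd dunkl (fun i _ j _ _ => dunkl_comm i j)

/-- The index set `{1, …, m}` inside `{1, …, n}`. -/
def initial (n m : ℕ) : Finset (Fin n) := Finset.univ.filter fun i => (i : ℕ) < m

open Classical in
/-- The pairs of sequences `((i_1, …, i_l), (j_1, …, j_l))` such that `i_1, …, i_l` are distinct
elements of `{1, …, m} ∖ S` (in any order) and `m < j_1 ≤ ⋯ ≤ j_l ≤ n`. -/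
noncomputable def pieriIndex (n m l : ℕ) (S : Finset (Fin n)) :
    Finset ((Fin l → Fin n) × (Fin l → Fin n)) :=
  Finset.univ.filter fun p =>
    Function.Injective p.1 ∧ (∀ a, p.1 a ∈ initial n m \ S) ∧
      (∀ a, p.2 a ∉ initial n m) ∧ Monotone p.2

/-- `N(a, 2b) = (2b - 1)!! * C(a + 2b, 2b)`. For `b = 0` the truncated subtraction gives
`0!! = 1`, in agreement with the convention `(-1)!! = 1`. -/
def pieriN (a b : ℕ) : ℕ := Nat.doubleFactorial (2 * b - 1) * Nat.choose (a + 2 * b) (2 * b)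

/-- The inner sum for given `r`: the sum of `X_S [i_1,j_1] ⋯ [i_l,j_l]` over all `S ⊆ {1, …, m}`,
all `l` with `l + |S| + 2r = k`, and all sequences as in `pieriIndex`. -/
noncomputable def pieriSum (n m k r : ℕ) : FKAlg n :=
  ∑ S ∈ (initial n m).powerset, ∑ l ∈ (Finset.range (k + 1)).filter (fun l => l + S.card + 2 * r = k),
    ∑ p ∈ pieriIndex n m l S, xProd S * (List.ofFn fun a : Fin l => br (p.1 a) (p.2 a)).prod

end FKAlg

/-! Induction on `m`, through `e_{k+1}(A ∪ {a}) = e_{k+1}(A) + e_k(A) θ_a` with `A = {1, …, m}` and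
`a = m + 1`. The right-hand side of the formula is rewritten as a sum over partitions `A = S ⊔ W ⊔
R` of `v(|R|) X_S Q(W)`, where `Q` is `brListSum` for the list of indices outside `A`, and `v(|R|) =
(-t)^r N(q, 2r)` when `|R| = q + 2r`, `q = m - k`.

Let `C` list the indices beyond `a`, so that `θ_a = x_a + ∑_{c ∈ C} [a,c] - ∑_{i ∈ A} [i,a]`.
Multiply `Q_{a::C}(W)` by this on the right. By `brListSum_cons_mul`, the brackets `[a,c]` together
with the `-[i,a]`, `i ∈ W`, give `Q_C(W ∪ {a})`. By `brListSum_cons_mul_x`, moving `x_a` to the left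
gives `x_a Q_C(W)`, terms with `x_i` that cancel the `-[i,a]` for `i ∈ S`, and terms in `-t` that
transfer an element from `W` to `R`. By `brListSum_cons_right`, the `-[i,a]` with `i ∈ R` yield
differences `Q_C - Q_{a::C}`. The leftover multiples of `Q_{a::C}` vanish if `v(r+1) = u(r) - t r
v(r-1)`, where `u` is the coefficient sequence for `e_{k+1}(A)`. What survives is the partition sum
for `A ∪ {a}`, with `a` in `S`, `W` or `R`.

The recurrence holds because `N(q, 2r)` counts the partial matchings of a set of `q + 2r` points
with `q` points unmatched: the last point is unmatched or paired with one of the others. The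
essential fact about the Fomin–Kirillov relations is `arrSum_mul_sum_eq_zero`. -/

section ArrSum

/-! ### Sums over orderings, under an abstract three-term relation (model: `p i = [i,c]`, `d i j =
[i,j]`). -/

variable {ι M : Type*} [DecidableEq ι] [Ring M]

/-- The sum of the products `p i₁ * ⋯ * p iₗ` over all orderings `i₁, …, iₗ` of `V`. -/
noncomputable def arrSum (p : ι → M) (V : Finset ι) : M :=
  if V = ∅ then 1 else ∑ i ∈ V.attach, p i * arrSum p (V.erase i)
termination_by V.card
decreasing_by exact Finset.card_erase_lt_of_mem i.2

theorem arrSum_empty (p : ι → M) : arrSum p ∅ = 1 := by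
  rw [arrSum, if_pos rfl]

theorem arrSum_left (p : ι → M) {V : Finset ι} (hV : V ≠ ∅) :
    arrSum p V = ∑ i ∈ V, p i * arrSum p (V.erase i) := by
  rw [arrSum, if_neg hV, Finset.sum_attach V (fun i => p i * arrSum p (V.erase i))]

theorem sum_erase_comm (V : Finset ι) (f : ι → ι → M) :
    ∑ k ∈ V, ∑ j ∈ V.erase k, f k j = ∑ j ∈ V, ∑ k ∈ V.erase j, f k j := by
  refine Finset.sum_comm' fun k j => ?_
  simp only [Finset.mem_erase]
  constructor
  · rintro ⟨h1, h2, h3⟩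
    exact ⟨⟨h2.symm, h1⟩, h3⟩
  · rintro ⟨⟨h1, h2⟩, h3⟩
    exact ⟨h2, h1.symm, h3⟩

theorem arrSum_right (p : ι → M) {V : Finset ι} (hV : V ≠ ∅) :
    arrSum p V = ∑ i ∈ V, arrSum p (V.erase i) * p i := by
  induction V using Finset.strongInduction with
  | H V ih =>
    by_cases h1 : ∃ a, V = {a}
    · obtain ⟨a, rfl⟩ := h1
      rw [arrSum_left p hV]
      simp [arrSum_empty]
    · have hne : ∀ i ∈ V, V.erase i ≠ ∅ := by
        intro i hi h
        refine h1 ⟨i, ?_⟩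
        rw [Finset.erase_eq_empty_iff] at h
        exact h.resolve_left hV
      rw [arrSum_left p hV]
      calc ∑ i ∈ V, p i * arrSum p (V.erase i)
          = ∑ i ∈ V, ∑ j ∈ V.erase i, p i * (arrSum p ((V.erase i).erase j) * p j) := by
            refine Finset.sum_congr rfl fun i hi => ?_
            rw [ih _ (Finset.erase_ssubset hi) (hne i hi), Finset.mul_sum]
        _ = ∑ j ∈ V, ∑ i ∈ V.erase j, p i * (arrSum p ((V.erase i).erase j) * p j) :=
            sum_erase_comm V _
        _ = _ := by
            refine Finset.sum_congr rfl fun j hj => ?_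
            rw [arrSum_left p (hne j hj), Finset.sum_mul]
            refine Finset.sum_congr rfl fun i _ => ?_
            rw [mul_assoc, Finset.erase_right_comm]

theorem commute_arrSum (p : ι → M) (d : M) (V : Finset ι) (h : ∀ i ∈ V, Commute d (p i)) :
    Commute d (arrSum p V) := by
  induction V using Finset.strongInduction with
  | H V ih =>
    by_cases hV : V = ∅
    · subst hV
      rw [arrSum_empty]
      exact Commute.one_right d
    · rw [arrSum_left p hV]
      refine Commute.sum_right _ _ _ fun i hi => (h i hi).mul_right ?_
      exact ih _ (Finset.erase_ssubset hi) fun j hj => h j (Finset.mem_of_mem_erase hj)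

theorem arrSum_insert (p : ι → M) {a : ι} {V : Finset ι} (ha : a ∉ V) :
    arrSum p (insert a V) = p a * arrSum p V + ∑ k ∈ V, p k * arrSum p (insert a (V.erase k)) := by
  rw [arrSum_left p (Finset.insert_ne_empty a V), Finset.sum_insert ha, Finset.erase_insert ha]
  congr 1
  refine Finset.sum_congr rfl fun k hk => ?_
  rw [Finset.erase_insert_of_ne (by rintro rfl; exact ha hk)]

/-- Insertion of one more index on the right, given exchange relations with elements `d j`. -/
theorem arrSum_insert_exchange (p d : ι → M) {a : ι} {V : Finset ι} (ha : a ∉ V)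
    (hpd : ∀ j ∈ V, p a * p j = p j * d j - d j * p a)
    (hc : ∀ j ∈ V, ∀ k ∈ V, j ≠ k → Commute (d j) (p k)) :
    arrSum p (insert a V) =
      arrSum p V * p a + ∑ j ∈ V, (arrSum p V * d j - d j * arrSum p (insert a (V.erase j))) := by
  induction V using Finset.strongInduction with
  | H V ih =>
    by_cases hV : V = ∅
    · subst hV
      rw [arrSum_insert p ha]
      simp [arrSum_empty]
    -- Orderings that do not start with `a`: split off the first letter `k` and apply induction to
    -- the rest. The outcome is the claimed formula without the terms in which `j` itself comes
    -- first.
    have key : ∑ k ∈ V, p k * arrSum p (insert a (V.erase k)) =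
        arrSum p V * p a + ∑ j ∈ V, (arrSum p V - p j * arrSum p (V.erase j)) * d j
        - ∑ j ∈ V, d j * (arrSum p (insert a (V.erase j)) - p a * arrSum p (V.erase j)) := by
      have e1 : ∑ j ∈ V, (arrSum p V - p j * arrSum p (V.erase j)) * d j =
          ∑ k ∈ V, ∑ j ∈ V.erase k, p k * (arrSum p (V.erase k) * d j) := by
        rw [sum_erase_comm]
        refine Finset.sum_congr rfl fun j hj => ?_
        rw [arrSum_left p hV, ← Finset.sum_erase_eq_sub hj, Finset.sum_mul]
        exact Finset.sum_congr rfl fun k _ => mul_assoc _ _ _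
      have e2 : ∑ j ∈ V, d j * (arrSum p (insert a (V.erase j)) - p a * arrSum p (V.erase j)) =
          ∑ k ∈ V, ∑ j ∈ V.erase k,
            p k * (d j * arrSum p (insert a ((V.erase k).erase j))) := by
        rw [sum_erase_comm]
        refine Finset.sum_congr rfl fun j hj => ?_
        rw [arrSum_insert p (fun h => ha (Finset.mem_of_mem_erase h)), add_sub_cancel_left,
          Finset.mul_sum]
        refine Finset.sum_congr rfl fun k hk => ?_
        rw [← mul_assoc, ← mul_assoc, (hc j hj k (Finset.mem_of_mem_erase hk)
          (Finset.ne_of_mem_erase hk).symm).eq, Finset.erase_right_comm]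
      have e3 : arrSum p V * p a = ∑ k ∈ V, p k * (arrSum p (V.erase k) * p a) := by
        rw [arrSum_left p hV, Finset.sum_mul]
        exact Finset.sum_congr rfl fun k _ => mul_assoc _ _ _
      rw [e1, e2, e3, ← Finset.sum_add_distrib, ← Finset.sum_sub_distrib]
      refine Finset.sum_congr rfl fun k hk => ?_
      have hk' : ∀ j ∈ V.erase k, j ∈ V := fun j hj => Finset.mem_of_mem_erase hj
      rw [ih _ (Finset.erase_ssubset hk) (fun h => ha (hk' _ h)) (fun j hj => hpd j (hk' j hj))
        (fun j hj l hl => hc j (hk' j hj) l (hk' l hl)), mul_add, Finset.mul_sum, add_sub_assoc,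
        ← Finset.sum_sub_distrib]
      simp only [mul_sub]
    -- Orderings that start with `a` supply exactly those missing terms: exchange `p a` with the
    -- next letter `p j`, then move `d j` past the remaining letters, with which it commutes.
    have last : p a * arrSum p V =
        ∑ j ∈ V, (p j * arrSum p (V.erase j) * d j - d j * (p a * arrSum p (V.erase j))) := by
      rw [arrSum_left p hV, Finset.mul_sum]
      refine Finset.sum_congr rfl fun j hj => ?_
      rw [← mul_assoc, hpd j hj, sub_mul, mul_assoc, mul_assoc, mul_assoc,
        (commute_arrSum p (d j) (V.erase j) fun k hk => hc j hj k (Finset.mem_of_mem_erase hk)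
          (Finset.ne_of_mem_erase hk).symm).eq]
    rw [arrSum_insert p ha, key, last]
    simp only [Finset.sum_sub_distrib, sub_mul, mul_sub]
    abel

/-- A generalization of `p i * p i = 0` to cyclic words. Single out one element `a`, so `V = U ∪
{a}`, and move `p a` to the right inside each word by `arrSum_insert_exchange`. The result consists
of instances of the claim for `U` and for the sets `(U \ {j}) ∪ {a}`, all smaller, plus terms that
cancel against the expansion of the word that begins and ends with `p a`. -/
theorem sum_mul_arrSum_mul_eq_zero (p : ι → M) (d : ι → ι → M) (V : Finset ι)
    (hsq : ∀ i ∈ V, p i * p i = 0)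
    (hpd : ∀ i ∈ V, ∀ j ∈ V, i ≠ j → p i * p j = p j * d i j - d i j * p i)
    (hc : ∀ i ∈ V, ∀ j ∈ V, ∀ k ∈ V, i ≠ j → i ≠ k → j ≠ k → Commute (d i j) (p k)) :
    ∑ i ∈ V, p i * arrSum p (V.erase i) * p i = 0 := by
  induction hN : V.card using Nat.strong_induction_on generalizing V with
  | _ N ih =>
    obtain rfl | ⟨a, ha⟩ := V.eq_empty_or_nonempty
    · simp
    obtain ⟨U, haU, rfl⟩ : ∃ U, a ∉ U ∧ insert a U = V :=
      ⟨V.erase a, Finset.notMem_erase a V, Finset.insert_erase ha⟩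
    have hU : ∀ j ∈ U, j ∈ insert a U := fun j hj => Finset.mem_insert_of_mem hj
    have hne : ∀ j ∈ U, a ≠ j := by rintro j hj rfl; exact haU hj
    rw [Finset.card_insert_of_notMem haU] at hN
    by_cases hUe : U = ∅
    · subst hUe
      simp [arrSum_empty, hsq a ha]
    have sub : ∀ W : Finset ι, W ⊆ insert a U → W.card < N →
        ∑ i ∈ W, p i * arrSum p (W.erase i) * p i = 0 := fun W hW hcard =>
      ih _ hcard W (fun i hi => hsq i (hW hi)) (fun i hi j hj => hpd i (hW hi) j (hW hj))
        (fun i hi j hj k hk => hc i (hW hi) j (hW hj) k (hW hk)) rfl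
    have expand : ∀ k ∈ U, p k * arrSum p ((insert a U).erase k) * p k =
        (p k * arrSum p (U.erase k) * p k * d a k
          - p k * d a k * arrSum p (U.erase k) * p a)
        + ∑ j ∈ U.erase k, (p k * arrSum p (U.erase k) * p k * d a j
          - d a j * (p k * arrSum p (insert a ((U.erase k).erase j)) * p k)) := by
      intro k hk
      have hk' : ∀ j ∈ U.erase k, j ∈ U := fun j hj => Finset.mem_of_mem_erase hj
      rw [Finset.erase_insert_of_ne (hne k hk), arrSum_insert_exchange p (d a)
        (fun h => haU (hk' _ h)) (fun j hj => hpd a ha j (hU j (hk' j hj)) (hne j (hk' j hj)))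
        (fun j hj l hl hjl => hc a ha j (hU j (hk' j hj)) l (hU l (hk' l hl)) (hne j (hk' j hj))
          (hne l (hk' l hl)) hjl)]
      have hcw : d a k * arrSum p (U.erase k) = arrSum p (U.erase k) * d a k :=
        (commute_arrSum p (d a k) (U.erase k) fun j hj => hc a ha k (hU k hk) j (hU j (hk' j hj))
          (hne k hk) (hne j (hk' j hj)) (Finset.ne_of_mem_erase hj).symm).eq
      rw [mul_add, add_mul, Finset.mul_sum, Finset.sum_mul]
      congr 1
      · rw [mul_assoc (p k) (d a k), hcw]
        simp only [mul_assoc]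
        rw [hpd a ha k (hU k hk) (hne k hk)]
        simp only [mul_sub]
      · refine Finset.sum_congr rfl fun j hj => ?_
        have hcd : d a j * p k = p k * d a j := (hc a ha j (hU j (hk' j hj)) k (hU k hk)
          (hne j (hk' j hj)) (hne k hk) (Finset.ne_of_mem_erase hj)).eq
        rw [mul_sub, sub_mul, ← mul_assoc (p k) (d a j), ← hcd]
        simp only [mul_assoc]
        rw [hcd]
    -- The instance for `U`: collecting the elements `d a j` on the right leaves the common factor
    -- `∑ j ∈ U, d a j`.
    have s1 : ∑ k ∈ U, (p k * arrSum p (U.erase k) * p k * d a k +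
        ∑ j ∈ U.erase k, p k * arrSum p (U.erase k) * p k * d a j) = 0 := by
      have : ∀ k ∈ U, p k * arrSum p (U.erase k) * p k * d a k +
          ∑ j ∈ U.erase k, p k * arrSum p (U.erase k) * p k * d a j =
          p k * arrSum p (U.erase k) * p k * ∑ j ∈ U, d a j := by
        intro k hk
        rw [Finset.add_sum_erase U (fun j => p k * arrSum p (U.erase k) * p k * d a j) hk,
          Finset.mul_sum]
      rw [Finset.sum_congr rfl this, ← Finset.sum_mul,
        sub U (Finset.subset_insert a U) (by omega), zero_mul]
    -- The instances for `insert a (U.erase j)`, each with its summand at `a` moved to the other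
    -- side.
    have s2 : ∑ k ∈ U, ∑ j ∈ U.erase k,
        d a j * (p k * arrSum p (insert a ((U.erase k).erase j)) * p k) =
        - ∑ j ∈ U, d a j * (p a * arrSum p (U.erase j) * p a) := by
      rw [sum_erase_comm, ← Finset.sum_neg_distrib]
      refine Finset.sum_congr rfl fun j hj => ?_
      have haj : a ∉ U.erase j := fun h => haU (Finset.mem_of_mem_erase h)
      have h0 := sub (insert a (U.erase j)) (Finset.insert_subset_insert a (Finset.erase_subset j U))
        (by rw [Finset.card_insert_of_notMem haj]
            have := Finset.card_erase_lt_of_mem hj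
            omega)
      rw [Finset.sum_insert haj, Finset.erase_insert haj] at h0
      rw [← Finset.mul_sum, ← mul_neg, ← eq_neg_of_add_eq_zero_right h0]
      congr 1
      refine Finset.sum_congr rfl fun k hk => ?_
      rw [Finset.erase_insert_of_ne (hne k (Finset.mem_of_mem_erase hk)), Finset.erase_right_comm]
    have s3 : p a * arrSum p U * p a = ∑ j ∈ U, (p j * d a j * arrSum p (U.erase j) * p a
        - d a j * (p a * arrSum p (U.erase j) * p a)) := by
      rw [arrSum_left p hUe, Finset.mul_sum, Finset.sum_mul]
      refine Finset.sum_congr rfl fun j hj => ?_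
      rw [← mul_assoc (p a), hpd a ha j (hU j hj) (hne j hj)]
      simp only [sub_mul, mul_assoc]
    rw [Finset.sum_insert haU, Finset.erase_insert haU, Finset.sum_congr rfl expand, s3]
    simp only [Finset.sum_add_distrib, Finset.sum_sub_distrib] at s1 ⊢
    rw [s2]
    refine Eq.trans ?_ s1
    abel

/-- Split off the first letter `p k`. The shorter word is killed by the sum over `V \ {k}` by
induction, so only the last factor `p k` remains, which is the cyclic sum above. -/
theorem arrSum_mul_sum_eq_zero (p : ι → M) (d : ι → ι → M) (V : Finset ι)
    (hsq : ∀ i ∈ V, p i * p i = 0)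
    (hpd : ∀ i ∈ V, ∀ j ∈ V, i ≠ j → p i * p j = p j * d i j - d i j * p i)
    (hc : ∀ i ∈ V, ∀ j ∈ V, ∀ k ∈ V, i ≠ j → i ≠ k → j ≠ k → Commute (d i j) (p k)) :
    arrSum p V * ∑ i ∈ V, p i = 0 := by
  induction V using Finset.strongInduction with
  | H V ih =>
    by_cases hV : V = ∅
    · simp [hV]
    rw [← sum_mul_arrSum_mul_eq_zero p d V hsq hpd hc, arrSum_left p hV, Finset.sum_mul]
    refine Finset.sum_congr rfl fun k hk => ?_
    have hk' : ∀ j ∈ V.erase k, j ∈ V := fun j hj => Finset.mem_of_mem_erase hj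
    rw [← Finset.add_sum_erase V p hk, mul_add, mul_assoc (p k) _ (∑ i ∈ V.erase k, p i),
      ih _ (Finset.erase_ssubset hk) (fun i hi => hsq i (hk' i hi))
        (fun i hi j hj => hpd i (hk' i hi) j (hk' j hj))
        (fun i hi j hj l hl => hc i (hk' i hi) j (hk' j hj) l (hk' l hl)), mul_zero, add_zero]

theorem arrSum_eq_left (p : ι → M) (V : Finset ι) :
    arrSum p V = (if V = ∅ then 1 else 0) + ∑ i ∈ V, p i * arrSum p (V.erase i) := by
  by_cases hV : V = ∅
  · simp [hV, arrSum_empty]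
  · rw [if_neg hV, zero_add, arrSum_left p hV]

theorem arrSum_eq_right (p : ι → M) (V : Finset ι) :
    arrSum p V = (if V = ∅ then 1 else 0) + ∑ i ∈ V, arrSum p (V.erase i) * p i := by
  by_cases hV : V = ∅
  · simp [hV, arrSum_empty]
  · rw [if_neg hV, zero_add, arrSum_right p hV]

/-! ### Moving an element between the blocks of a set partition. -/

theorem sum_powerset_sum_mem (D : Finset ι) (f : ι → Finset ι → Finset ι → M) :
    ∑ W ∈ D.powerset, ∑ i ∈ W, f i (W.erase i) (D \ W) =
      ∑ i ∈ D, ∑ W ∈ (D.erase i).powerset, f i W (D.erase i \ W) := by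
  rw [Finset.sum_sigma', Finset.sum_sigma']
  refine Finset.sum_bij' (fun p _ => ⟨p.2, p.1.erase p.2⟩) (fun p _ => ⟨insert p.1 p.2, p.1⟩)
    ?_ ?_ ?_ ?_ ?_
  · rintro ⟨W, i⟩ h
    simp only [Finset.mem_sigma, Finset.mem_powerset] at h ⊢
    exact ⟨h.1 h.2, Finset.erase_subset_erase i h.1⟩
  · rintro ⟨i, W⟩ h
    simp only [Finset.mem_sigma, Finset.mem_powerset] at h ⊢
    exact ⟨Finset.insert_subset h.1 (h.2.trans (Finset.erase_subset i D)),
      Finset.mem_insert_self i W⟩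
  · rintro ⟨W, i⟩ h
    simp only [Finset.mem_sigma, Finset.mem_powerset] at h
    simp [Finset.insert_erase h.2]
  · rintro ⟨i, W⟩ h
    simp only [Finset.mem_sigma, Finset.mem_powerset] at h
    have : i ∉ W := fun hi => Finset.notMem_erase i D (h.2 hi)
    simp [Finset.erase_insert this]
  · rintro ⟨W, i⟩ h
    simp only [Finset.mem_sigma, Finset.mem_powerset] at h
    congr 1
    ext j
    simp only [Finset.mem_sdiff, Finset.mem_erase]
    grind

theorem sum_powerset_sum_sdiff (D : Finset ι) (f : ι → Finset ι → Finset ι → M) :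
    ∑ W ∈ D.powerset, ∑ i ∈ D \ W, f i W ((D \ W).erase i) =
      ∑ i ∈ D, ∑ W ∈ (D.erase i).powerset, f i W (D.erase i \ W) := by
  have : ∑ i ∈ D, ∑ W ∈ (D.erase i).powerset, f i W (D.erase i \ W) =
      ∑ W ∈ D.powerset, ∑ i ∈ D \ W, f i W (D.erase i \ W) := by
    refine Finset.sum_comm' fun i W => ?_
    simp only [Finset.mem_powerset, Finset.mem_sdiff, Finset.subset_erase]
    tauto
  rw [this]
  simp only [Finset.erase_sdiff_comm]

/-- Moving one element from one part of a partition of `D` to the other. -/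
theorem sum_powerset_exchange (D : Finset ι) (f : ι → Finset ι → Finset ι → M) :
    ∑ W ∈ D.powerset, ∑ i ∈ W, f i (W.erase i) (D \ W) =
      ∑ W ∈ D.powerset, ∑ i ∈ D \ W, f i W ((D \ W).erase i) := by
  rw [sum_powerset_sum_mem, sum_powerset_sum_sdiff]

/-- The partitions `A = S ⊔ W ⊔ R` may be indexed by `(R, W)` instead of `(S, W)`; this allows an
exchange between `S` and `W` with `R` fixed. -/
theorem sum_powerset_sdiff_swap (A : Finset ι) (f : Finset ι → Finset ι → Finset ι → M) :
    ∑ S ∈ A.powerset, ∑ W ∈ (A \ S).powerset, f S W ((A \ S) \ W) =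
      ∑ R ∈ A.powerset, ∑ W ∈ (A \ R).powerset, f ((A \ R) \ W) W R := by
  rw [Finset.sum_sigma', Finset.sum_sigma']
  have hmem : ∀ p ∈ A.powerset.sigma fun S => (A \ S).powerset,
      (⟨(A \ p.1) \ p.2, p.2⟩ : (_ : Finset ι) × Finset ι) ∈
        A.powerset.sigma fun S => (A \ S).powerset := by
    rintro ⟨S, W⟩ h
    simp only [Finset.mem_sigma, Finset.mem_powerset, Finset.subset_iff, Finset.mem_sdiff] at h ⊢
    grind
  have hinv : ∀ p ∈ A.powerset.sigma fun S => (A \ S).powerset,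
      (A \ ((A \ p.1) \ p.2)) \ p.2 = p.1 := by
    rintro ⟨S, W⟩ h
    simp only [Finset.mem_sigma, Finset.mem_powerset, Finset.subset_iff, Finset.mem_sdiff] at h ⊢
    ext j
    simp only [Finset.mem_sdiff]
    grind
  refine Finset.sum_bij' (fun p _ => ⟨(A \ p.1) \ p.2, p.2⟩) (fun p _ => ⟨(A \ p.1) \ p.2, p.2⟩)
    hmem hmem ?_ ?_ ?_
  · intro p h
    simp only [hinv p h]
  · intro p h
    simp only [hinv p h]
  · intro p h
    simp only [hinv p h]

end ArrSum

/-! ### Bracket relations in the form required by the abstract lemmas. -/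

namespace FKAlg

variable {n : ℕ}

theorem br_sq (i j : Fin n) (hij : i ≠ j) : br i j * br i j = 0 := by
  have h := mk_rel (FKRel.sq i j hij)
  simp only [map_mul, map_zero] at h
  exact h

theorem commute_x_t (i : Fin n) : Commute (x i) t := by
  have h := mk_rel (FKRel.x_t i)
  simp only [map_mul] at h
  exact h

theorem commute_br_t (i j : Fin n) (hij : i ≠ j) : Commute (br i j) t := by
  have h := mk_rel (FKRel.br_t i j hij)
  simp only [map_mul] at h
  exact h

theorem commute_br_br {i j k l : Fin n} (hij : i ≠ j) (hkl : k ≠ l)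
    (hik : i ≠ k) (hil : i ≠ l) (hjk : j ≠ k) (hjl : j ≠ l) : Commute (br i j) (br k l) :=
  br_comm i j k l hij hkl hik hil hjk hjl

/-- Reversing a bracket changes its sign, and so does the `t` in the two ordered relations; hence
one formula covers both `i < j` and `j < i`. -/
theorem br_mul_x (i j : Fin n) (hij : i ≠ j) : br i j * x j = x i * br i j - t := by
  rcases lt_or_gt_of_ne hij with h | h
  · exact br_x_right i j h
  · rw [br_antisymm i j hij, neg_mul, br_x_left j i h, mul_neg]
    abel

theorem br_mul_br (i j c : Fin n) (hij : i ≠ j) (hic : i ≠ c) (hjc : j ≠ c) :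
    br i c * br j c = br j c * br i j - br i j * br i c := by
  have h := br_three j i c hij.symm hic hjc.symm
  rw [br_antisymm j i hij.symm, br_antisymm c j hjc.symm] at h
  simp only [neg_mul, mul_neg, neg_neg] at h
  rw [← sub_eq_zero, ← neg_eq_zero, ← h]
  abel

/-! ### Bracket sums along a list: recursions and right multiplication. -/

/-- For a list `C` of indices, the sum of the products `[i₁,j₁] ⋯ [iₗ,jₗ]` over all orderings
`i₁, …, iₗ` of `U` and all sequences `j₁, …, jₗ` in `C` that respect the order of `C`. -/
noncomputable def brListSum : List (Fin n) → Finset (Fin n) → FKAlg n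
  | [], U => if U = ∅ then 1 else 0
  | c :: C, U => ∑ V ∈ U.powerset, arrSum (fun i => br i c) V * brListSum C (U \ V)

theorem commute_brListSum (d : FKAlg n) (C : List (Fin n)) (U : Finset (Fin n))
    (h : ∀ i ∈ U, ∀ c ∈ C, Commute d (br i c)) : Commute d (brListSum C U) := by
  induction C generalizing U with
  | nil =>
    rw [brListSum]
    split_ifs
    · exact Commute.one_right d
    · exact Commute.zero_right d
  | cons c C ih =>
    rw [brListSum]
    refine Commute.sum_right _ _ _ fun V hV => ?_
    rw [Finset.mem_powerset] at hV
    refine (commute_arrSum _ _ _ fun i hi => h i (hV hi) c (by simp)).mul_right (ih _ ?_)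
    exact fun i hi c' hc' => h i (Finset.mem_sdiff.mp hi).1 c' (by simp [hc'])

theorem brListSum_empty (C : List (Fin n)) : brListSum C ∅ = 1 := by
  induction C with
  | nil => simp [brListSum]
  | cons c C ih => simp [brListSum, ih, arrSum_empty]

theorem sum_powerset_ite_empty_mul (U : Finset (Fin n)) (g : Finset (Fin n) → FKAlg n) :
    ∑ V ∈ U.powerset, (if V = ∅ then 1 else 0) * g (U \ V) = g U := by
  rw [Finset.sum_eq_single_of_mem ∅ (Finset.empty_mem_powerset U) (fun V _ hV => by simp [hV])]
  simp

theorem brListSum_cons_left (c : Fin n) (C : List (Fin n)) (U : Finset (Fin n)) :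
    brListSum (c :: C) U =
      brListSum C U + ∑ i ∈ U, br i c * brListSum (c :: C) (U.erase i) := by
  rw [brListSum]
  calc ∑ V ∈ U.powerset, arrSum (fun i => br i c) V * brListSum C (U \ V)
      = ∑ V ∈ U.powerset, (if V = ∅ then 1 else 0) * brListSum C (U \ V) +
        ∑ V ∈ U.powerset, ∑ i ∈ V,
          br i c * (arrSum (fun i => br i c) (V.erase i) * brListSum C (U \ V)) := by
        rw [← Finset.sum_add_distrib]
        refine Finset.sum_congr rfl fun V _ => ?_
        rw [arrSum_eq_left, add_mul, Finset.sum_mul]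
        simp only [mul_assoc]
    _ = _ := by
        rw [sum_powerset_ite_empty_mul U, sum_powerset_sum_mem U
          (fun i V R => br i c * (arrSum (fun i => br i c) V * brListSum C R))]
        congr 1
        refine Finset.sum_congr rfl fun i _ => ?_
        rw [brListSum, Finset.mul_sum]

/-- Although `c` heads the list, `[i,c]` can be split off at the right end: it commutes with the
brackets of the later blocks, which share no index with it. -/
theorem brListSum_cons_right {c : Fin n} {C : List (Fin n)} {U : Finset (Fin n)}
    (hcC : c ∉ C) (hcU : c ∉ U) (hUC : ∀ i ∈ U, i ∉ C) :
    brListSum (c :: C) U =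
      brListSum C U + ∑ i ∈ U, brListSum (c :: C) (U.erase i) * br i c := by
  rw [brListSum]
  calc ∑ V ∈ U.powerset, arrSum (fun i => br i c) V * brListSum C (U \ V)
      = ∑ V ∈ U.powerset, (if V = ∅ then 1 else 0) * brListSum C (U \ V) +
        ∑ V ∈ U.powerset, ∑ i ∈ V,
          arrSum (fun i => br i c) (V.erase i) * brListSum C (U \ V) * br i c := by
        rw [← Finset.sum_add_distrib]
        refine Finset.sum_congr rfl fun V hV => ?_
        rw [Finset.mem_powerset] at hV
        rw [arrSum_eq_right, add_mul, Finset.sum_mul]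
        congr 1
        refine Finset.sum_congr rfl fun i hi => ?_
        have : Commute (br i c) (brListSum C (U \ V)) := by
          refine commute_brListSum _ _ _ fun j hj k hk => ?_
          rw [Finset.mem_sdiff] at hj
          refine commute_br_br ?_ ?_ ?_ ?_ ?_ ?_
          · rintro rfl; exact hcU (hV hi)
          · rintro rfl; exact hUC _ hj.1 hk
          · rintro rfl; exact hj.2 hi
          · rintro rfl; exact hUC _ (hV hi) hk
          · rintro rfl; exact hcU hj.1
          · rintro rfl; exact hcC hk
        rw [mul_assoc, this.eq, mul_assoc]
    _ = _ := by
        rw [sum_powerset_ite_empty_mul U, sum_powerset_sum_mem U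
          (fun i V R => arrSum (fun i => br i c) V * brListSum C R * br i c)]
        congr 1
        refine Finset.sum_congr rfl fun i _ => ?_
        rw [brListSum, Finset.sum_mul]

theorem brListSum_cons_insert {a c : Fin n} {C : List (Fin n)} {U : Finset (Fin n)} (haU : a ∉ U) :
    brListSum (c :: C) (insert a U) =
      ∑ V ∈ U.powerset, arrSum (fun i => br i c) V * brListSum C (insert a (U \ V)) +
      ∑ V ∈ U.powerset, arrSum (fun i => br i c) (insert a V) * brListSum C (U \ V) := by
  rw [brListSum, Finset.sum_powerset_insert haU]
  congr 1
  · refine Finset.sum_congr rfl fun V hV => ?_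
    rw [Finset.mem_powerset] at hV
    rw [Finset.insert_sdiff_of_notMem _ (fun h => haU (hV h))]
  · refine Finset.sum_congr rfl fun V hV => ?_
    rw [Finset.insert_sdiff_insert, Finset.sdiff_insert_of_notMem haU]

theorem arrSum_br_insert {a c : Fin n} {V : Finset (Fin n)} (ha : a ∉ V) (hac : a ≠ c)
    (hc : c ∉ V) :
    arrSum (fun i => br i c) (insert a V) =
      arrSum (fun i => br i c) V * br a c -
        ∑ j ∈ V, (arrSum (fun i => br i c) V * br j a
          - br j a * arrSum (fun i => br i c) (insert a (V.erase j))) := by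
  have hne : ∀ j ∈ V, a ≠ j ∧ j ≠ c := fun j hj =>
    ⟨by rintro rfl; exact ha hj, by rintro rfl; exact hc hj⟩
  rw [arrSum_insert_exchange (fun i => br i c) (fun j => br a j) ha
    (fun j hj => br_mul_br a j c (hne j hj).1 hac (hne j hj).2)
    (fun j hj k hk hjk => commute_br_br (hne j hj).1 (hne k hk).2 (hne k hk).1 hac hjk
      (hne j hj).2), sub_eq_add_neg, ← Finset.sum_neg_distrib]
  congr 1
  refine Finset.sum_congr rfl fun j hj => ?_
  rw [br_antisymm a j (hne j hj).1]
  simp only [mul_neg, neg_mul]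
  abel

/-- The list version of `arrSum_insert_exchange`. The new index `a` joins either the block of the
head `c` or a later block; in both cases the correction factors `[i,a]` commute past the block not
containing `i`, so the corrections have the same shape and add up. -/
theorem brListSum_insert {a : Fin n} {C : List (Fin n)} {U : Finset (Fin n)} (haU : a ∉ U)
    (haC : a ∉ C) (hC : C.Nodup) (hUC : ∀ i ∈ U, i ∉ C) :
    brListSum C (insert a U) = brListSum C U * (C.map (br a)).sum -
      ∑ i ∈ U, (brListSum C U * br i a - br i a * brListSum C (insert a (U.erase i))) := by
  induction C generalizing U with
  | nil =>
    by_cases hU : U = ∅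
    · simp [hU, brListSum]
    · simp [hU, brListSum]
  | cons c C ih =>
    simp only [List.mem_cons, not_or] at haC hUC
    rw [List.nodup_cons] at hC
    have hne : ∀ i ∈ U, a ≠ i := by rintro i hi rfl; exact haU hi
    have hcU : c ∉ U := fun h => (hUC c h).1 rfl
    set w := arrSum (fun i => br i c) with hw
    set G := brListSum C with hG
    have hcomm1 : ∀ V ⊆ U, Commute (br a c) (G (U \ V)) := by
      intro V hV
      refine commute_brListSum _ _ _ fun j hj k hk => ?_
      rw [Finset.mem_sdiff] at hj
      refine commute_br_br haC.1 ?_ (hne j hj.1) ?_ (Ne.symm (hUC j hj.1).1) ?_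
      · rintro rfl; exact (hUC _ hj.1).2 hk
      · rintro rfl; exact haC.2 hk
      · rintro rfl; exact hC.1 hk
    have hcomm2 : ∀ V ⊆ U, ∀ i ∈ V, Commute (br i a) (G (U \ V)) := by
      intro V hV i hi
      refine commute_brListSum _ _ _ fun j hj k hk => ?_
      rw [Finset.mem_sdiff] at hj
      refine commute_br_br (hne i (hV hi)).symm ?_ ?_ ?_ (hne j hj.1) ?_
      · rintro rfl; exact (hUC _ hj.1).2 hk
      · rintro rfl; exact hj.2 hi
      · rintro rfl; exact (hUC _ (hV hi)).2 hk
      · rintro rfl; exact haC.2 hk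
    have hcomm3 : ∀ V ⊆ U, ∀ i ∈ U \ V, Commute (br i a) (w V) := by
      intro V hV i hi
      rw [Finset.mem_sdiff] at hi
      refine commute_arrSum _ _ _ fun j hj => ?_
      refine commute_br_br (hne i hi.1).symm (hUC j (hV hj)).1 ?_ (hUC i hi.1).1 (hne j (hV hj))
        haC.1
      rintro rfl; exact hi.2 hj
    have e1 : ∀ V ∈ U.powerset, w V * G (insert a (U \ V)) + w (insert a V) * G (U \ V) =
        w V * G (U \ V) * ((br a c + (C.map (br a)).sum) - ∑ i ∈ U, br i a)
        + (∑ i ∈ U \ V, br i a * (w V * G (insert a ((U \ V).erase i)))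
          + ∑ i ∈ V, br i a * (w (insert a (V.erase i)) * G (U \ V))) := by
      intro V hV
      rw [Finset.mem_powerset] at hV
      rw [ih (fun h => haU (Finset.mem_sdiff.mp h).1) haC.2 hC.2
        (fun i hi => (hUC i (Finset.mem_sdiff.mp hi).1).2),
        hw, arrSum_br_insert (fun h => haU (hV h)) haC.1 (fun h => hcU (hV h)), ← hw,
        ← Finset.sum_sdiff hV]
      have f1 : ∑ i ∈ U \ V, br i a * (w V * G (insert a ((U \ V).erase i))) =
          w V * ∑ i ∈ U \ V, br i a * G (insert a ((U \ V).erase i)) := by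
        rw [Finset.mul_sum]
        refine Finset.sum_congr rfl fun i hi => ?_
        rw [← mul_assoc, (hcomm3 V hV i hi).eq, mul_assoc]
      have f2 : w V * (∑ i ∈ V, br i a) * G (U \ V) = w V * G (U \ V) * ∑ i ∈ V, br i a := by
        rw [mul_assoc, mul_assoc, (Commute.sum_left _ _ _ fun i hi => hcomm2 V hV i hi).eq]
      have f3 : ∑ i ∈ V, br i a * (w (insert a (V.erase i)) * G (U \ V)) =
          (∑ i ∈ V, br i a * w (insert a (V.erase i))) * G (U \ V) := by
        rw [Finset.sum_mul]
        simp only [mul_assoc]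
      have f4 : w V * br a c * G (U \ V) = w V * G (U \ V) * br a c := by
        rw [mul_assoc, (hcomm1 V hV).eq, mul_assoc]
      rw [f1, f3]
      simp only [Finset.sum_sub_distrib, ← Finset.mul_sum]
      rw [sub_mul (w V * br a c), sub_mul (w V * _), f2, f4]
      simp only [mul_sub, mul_add, mul_assoc]
      abel
    rw [brListSum_cons_insert haU, ← hw, ← hG, ← Finset.sum_add_distrib,
      Finset.sum_congr rfl e1, Finset.sum_add_distrib, Finset.sum_add_distrib,
      sum_powerset_sum_sdiff U (fun i V R => br i a * (w V * G (insert a R))),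
      sum_powerset_sum_mem U (fun i V R => br i a * (w (insert a V) * G R)),
      ← Finset.sum_mul, ← Finset.sum_add_distrib, Finset.sum_sub_distrib, ← Finset.mul_sum]
    have e2 : ∀ i ∈ U, br i a * brListSum (c :: C) (insert a (U.erase i)) =
        ∑ V ∈ (U.erase i).powerset, br i a * (w V * G (insert a (U.erase i \ V))) +
        ∑ V ∈ (U.erase i).powerset, br i a * (w (insert a V) * G (U.erase i \ V)) := by
      intro i _
      rw [brListSum_cons_insert (fun h => haU (Finset.mem_of_mem_erase h)), mul_add,
        Finset.mul_sum, Finset.mul_sum]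
    rw [Finset.sum_congr rfl e2, brListSum, List.map_cons, List.sum_cons]
    simp only [mul_sub]
    abel

/-- Multiplication by the part of a Dunkl element absorbs the head of the list. -/
theorem brListSum_cons_mul {a : Fin n} {C : List (Fin n)} {W : Finset (Fin n)} (haW : a ∉ W)
    (haC : a ∉ C) (hC : C.Nodup) (hWC : ∀ i ∈ W, i ∉ C) :
    brListSum (a :: C) W * ((C.map (br a)).sum - ∑ i ∈ W, br i a) = brListSum C (insert a W) := by
  have hne : ∀ i ∈ W, i ≠ a := by rintro i hi rfl; exact haW hi
  set w := arrSum (fun i => br i a) with hw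
  set G := brListSum C with hG
  have e1 : ∀ V ∈ W.powerset, w V * G (W \ V) * ((C.map (br a)).sum - ∑ i ∈ W, br i a) =
      w V * G (insert a (W \ V)) -
        ∑ i ∈ W \ V, w V * br i a * G (insert a ((W \ V).erase i)) := by
    intro V hV
    rw [Finset.mem_powerset] at hV
    have hcomm : Commute (∑ i ∈ V, br i a) (G (W \ V)) := by
      refine Commute.sum_left _ _ _ fun i hi => commute_brListSum _ _ _ fun j hj k hk => ?_
      rw [Finset.mem_sdiff] at hj
      refine commute_br_br (hne i (hV hi)) ?_ ?_ ?_ (hne j hj.1).symm ?_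
      · rintro rfl; exact hWC _ hj.1 hk
      · rintro rfl; exact hj.2 hi
      · rintro rfl; exact hWC _ (hV hi) hk
      · rintro rfl; exact haC hk
    -- The vanishing lemma removes the brackets `[i,a]` whose `i` is already joined to `a` by the
    -- first block.
    have hzero : w V * G (W \ V) * ∑ i ∈ V, br i a = 0 := by
      rw [mul_assoc, ← hcomm.eq, ← mul_assoc, hw,
        arrSum_mul_sum_eq_zero (fun i => br i a) br V
          (fun i hi => br_sq i a (hne i (hV hi)))
          (fun i hi j hj hij => br_mul_br i j a hij (hne i (hV hi)) (hne j (hV hj)))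
          (fun i hi j hj k hk hij hik hjk => commute_br_br hij (hne k (hV hk)) hik
            (hne i (hV hi)) hjk (hne j (hV hj))), zero_mul]
    rw [← Finset.sum_sdiff hV, ← sub_sub, mul_sub (w V * G (W \ V)) _ (∑ i ∈ V, br i a), hzero,
      sub_zero, hG, brListSum_insert (fun h => haW (Finset.mem_sdiff.mp h).1) haC hC
        (fun i hi => hWC i (Finset.mem_sdiff.mp hi).1), ← hG]
    simp only [Finset.sum_sub_distrib, mul_sub, ← Finset.mul_sum, mul_assoc]
    abel
  -- Transferring `i` from `W \ V` to `V` turns the correction terms into `arrSum` over `V` with its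
  -- last letter split off. They cancel everything except `V = ∅`.
  rw [brListSum, ← hw, ← hG, Finset.sum_mul, Finset.sum_congr rfl e1, Finset.sum_sub_distrib,
    ← sum_powerset_exchange W (fun i V R => w V * br i a * G (insert a R)),
    ← Finset.sum_sub_distrib, ← sum_powerset_ite_empty_mul W (fun V => G (insert a V))]
  refine Finset.sum_congr rfl fun V _ => ?_
  rw [hw, arrSum_eq_right _ V, add_mul, Finset.sum_mul, add_sub_cancel_right]

/-- With the last factor `[i,a]` split off, `[i,a] x_a = x_i [i,a] - t`; then `x_i` passes through
the rest, where neither `i` nor any bracket with `i` occurs. -/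
theorem brListSum_cons_mul_x {a : Fin n} {C : List (Fin n)} {W : Finset (Fin n)} (haW : a ∉ W)
    (haC : a ∉ C) (hWC : ∀ i ∈ W, i ∉ C) :
    brListSum (a :: C) W * x a = x a * brListSum C W +
      ∑ i ∈ W, x i * (brListSum (a :: C) (W.erase i) * br i a) -
      t * ∑ i ∈ W, brListSum (a :: C) (W.erase i) := by
  have hne : ∀ i ∈ W, i ≠ a := by rintro i hi rfl; exact haW hi
  have hx : Commute (x a) (brListSum C W) := by
    refine commute_brListSum _ _ _ fun j hj k hk => (br_x_of_ne j k a ?_ ?_ ?_).symm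
    · rintro rfl; exact hWC _ hj hk
    · exact (hne j hj).symm
    · rintro rfl; exact haC hk
  rw [brListSum_cons_right haC haW hWC, add_mul, ← hx.eq, Finset.sum_mul, Finset.mul_sum,
    add_sub_assoc, ← Finset.sum_sub_distrib]
  congr 1
  refine Finset.sum_congr rfl fun i hi => ?_
  have hxi : Commute (x i) (brListSum (a :: C) (W.erase i)) := by
    refine commute_brListSum _ _ _ fun j hj k hk => ?_
    rw [Finset.mem_erase] at hj
    rw [List.mem_cons] at hk
    refine (br_x_of_ne j k i ?_ hj.1.symm ?_).symm
    · rintro rfl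
      exact hk.elim (hne _ hj.2) (hWC _ hj.2)
    · rintro rfl
      exact hk.elim (hne _ hi) (hWC _ hi)
  have ht : Commute t (brListSum (a :: C) (W.erase i)) := by
    refine commute_brListSum _ _ _ fun j hj k hk => (commute_br_t j k ?_).symm
    rw [Finset.mem_erase] at hj
    rw [List.mem_cons] at hk
    rintro rfl
    exact hk.elim (hne _ hj.2) (hWC _ hj.2)
  rw [mul_assoc, br_mul_x i a (hne i hi), mul_sub, ← mul_assoc, ← hxi.eq, mul_assoc, ht.eq]

/-! ### Partition sums and multiplication by a Dunkl element. -/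

theorem xProd_empty : xProd (∅ : Finset (Fin n)) = 1 :=
  Finset.noncommProd_empty _ _

theorem xProd_insert {i : Fin n} {S : Finset (Fin n)} (hi : i ∉ S) :
    xProd (insert i S) = xProd S * x i :=
  Finset.noncommProd_insert_of_notMem' S i x _ hi

theorem commute_t_xProd (S : Finset (Fin n)) : Commute t (xProd S) :=
  Finset.noncommProd_commute S x _ t fun i _ => (commute_x_t i).symm

/-- The sum of `v #R * X_S * brListSum C W` over all partitions of `A` into `S`, `W`, `R`. -/
noncomputable def partitionSum (v : ℕ → FKAlg n) (A : Finset (Fin n)) (C : List (Fin n)) :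
    FKAlg n :=
  ∑ S ∈ A.powerset, ∑ W ∈ (A \ S).powerset, v ((A \ S) \ W).card * xProd S * brListSum C W

theorem partitionSum_insert_eq (v : ℕ → FKAlg n) {A : Finset (Fin n)} {a : Fin n} (ha : a ∉ A)
    (C : List (Fin n)) :
    partitionSum v (insert a A) C = ∑ S ∈ A.powerset, ∑ W ∈ (A \ S).powerset,
      (v (((A \ S) \ W).card + 1) * xProd S * brListSum C W
        + v ((A \ S) \ W).card * xProd S * brListSum C (insert a W)
        + v ((A \ S) \ W).card * xProd S * (x a * brListSum C W)) := by
  rw [partitionSum, Finset.sum_powerset_insert ha, ← Finset.sum_add_distrib]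
  refine Finset.sum_congr rfl fun S hS => ?_
  rw [Finset.mem_powerset] at hS
  have haS : a ∉ S := fun h => ha (hS h)
  have haD : a ∉ A \ S := fun h => ha (Finset.mem_sdiff.mp h).1
  rw [Finset.insert_sdiff_of_notMem _ haS, Finset.sum_powerset_insert haD,
    Finset.insert_sdiff_insert, Finset.sdiff_insert_of_notMem ha, xProd_insert haS,
    ← Finset.sum_add_distrib, ← Finset.sum_add_distrib]
  refine Finset.sum_congr rfl fun W hW => ?_
  rw [Finset.mem_powerset] at hW
  have haW : a ∉ W := fun h => haD (hW h)
  rw [Finset.insert_sdiff_of_notMem _ haW, Finset.insert_sdiff_insert,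
    Finset.sdiff_insert_of_notMem haD,
    Finset.card_insert_of_notMem (fun h => haD (Finset.mem_sdiff.mp h).1)]
  simp only [mul_assoc]

/-- The inductive step, with the coefficients kept abstract. At `r = 0` the truncated `r - 1` is
harmless, because of the factor `r`. -/
theorem partitionSum_mul_dunkl (u v : ℕ → FKAlg n) {A : Finset (Fin n)} {a : Fin n}
    {C : List (Fin n)} (haA : a ∉ A) (haC : a ∉ C) (hC : C.Nodup) (hAC : ∀ i ∈ A, i ∉ C)
    (hv : ∀ r, Commute t (v r)) (huv : ∀ r, v (r + 1) = u r - t * ((r : FKAlg n) * v (r - 1))) :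
    partitionSum u A (a :: C) +
        partitionSum v A (a :: C) * (x a + ((C.map (br a)).sum - ∑ i ∈ A, br i a)) =
      partitionSum v (insert a A) C := by
  set Q := brListSum (a :: C) with hQ
  set G := brListSum C with hG
  have term : ∀ S ∈ A.powerset, ∀ W ∈ (A \ S).powerset,
      v ((A \ S) \ W).card * xProd S * Q W * (x a + ((C.map (br a)).sum - ∑ i ∈ A, br i a)) =
      v ((A \ S) \ W).card * xProd S * (x a * G W)
      + v ((A \ S) \ W).card * xProd S * G (insert a W)
      + ∑ i ∈ W, v ((A \ S) \ W).card * xProd (insert i S) * (Q (W.erase i) * br i a)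
      - ∑ i ∈ S, v ((A \ S) \ W).card * xProd S * (Q W * br i a)
      - ∑ i ∈ W, v ((A \ S) \ W).card * xProd S * (t * Q (W.erase i))
      - ∑ i ∈ (A \ S) \ W, v ((A \ S) \ W).card * xProd S * (Q W * br i a) := by
    intro S hS W hW
    rw [Finset.mem_powerset] at hS hW
    have hWA : ∀ i ∈ W, i ∈ A := fun i hi => (Finset.mem_sdiff.mp (hW hi)).1
    have haW : a ∉ W := fun h => haA (hWA a h)
    have hWC : ∀ i ∈ W, i ∉ C := fun i hi => hAC i (hWA i hi)
    have e1 : ∀ i ∈ W, v ((A \ S) \ W).card * xProd (insert i S) * (Q (W.erase i) * br i a) =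
        v ((A \ S) \ W).card * xProd S * (x i * (Q (W.erase i) * br i a)) := by
      intro i hi
      rw [xProd_insert (Finset.mem_sdiff.mp (hW hi)).2]
      simp only [mul_assoc]
    rw [Finset.sum_congr rfl e1, ← Finset.sum_sdiff hS, ← Finset.sum_sdiff hW]
    simp only [← Finset.mul_sum]
    have m1 := brListSum_cons_mul_x haW haC hWC
    have m2 := brListSum_cons_mul haW haC hC hWC
    rw [← hQ, ← hG] at m1 m2
    rw [← m2, mul_assoc _ (Q W) (x a + _), mul_add (Q W) (x a), m1]
    simp only [mul_sub, mul_add]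
    abel
  -- Moving `i` from `W` to `S`: the `x_i` terms match the subtracted brackets with `i ∈ S`.
  have exch1 : ∑ S ∈ A.powerset, ∑ W ∈ (A \ S).powerset,
      ∑ i ∈ W, v ((A \ S) \ W).card * xProd (insert i S) * (Q (W.erase i) * br i a) =
      ∑ S ∈ A.powerset, ∑ W ∈ (A \ S).powerset,
        ∑ i ∈ S, v ((A \ S) \ W).card * xProd S * (Q W * br i a) := by
    rw [sum_powerset_sdiff_swap A (fun S W R =>
      ∑ i ∈ W, v R.card * xProd (insert i S) * (Q (W.erase i) * br i a)),
      sum_powerset_sdiff_swap A (fun S W R => ∑ i ∈ S, v R.card * xProd S * (Q W * br i a))]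
    refine Finset.sum_congr rfl fun R _ => ?_
    rw [sum_powerset_exchange (A \ R) (fun i W S =>
      v R.card * xProd (insert i S) * (Q W * br i a))]
    refine Finset.sum_congr rfl fun W _ => Finset.sum_congr rfl fun i hi => ?_
    rw [Finset.insert_erase hi]
  -- Moving `i` from `W` to `R`: the new `R` arises once for each of its elements, hence the factor
  -- `|R|`.
  have exch2 : ∀ S, ∑ W ∈ (A \ S).powerset,
      ∑ i ∈ W, v ((A \ S) \ W).card * xProd S * (t * Q (W.erase i)) =
      ∑ W ∈ (A \ S).powerset,
        t * ((((A \ S) \ W).card : FKAlg n) * v (((A \ S) \ W).card - 1)) * xProd S * Q W := by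
    intro S
    rw [sum_powerset_exchange (A \ S) (fun i W R => v R.card * xProd S * (t * Q W))]
    refine Finset.sum_congr rfl fun W _ => ?_
    have : ∀ i ∈ (A \ S) \ W, v (((A \ S) \ W).erase i).card * xProd S * (t * Q W) =
        t * v (((A \ S) \ W).card - 1) * xProd S * Q W := by
      intro i hi
      rw [Finset.card_erase_of_mem hi, ← mul_assoc, mul_assoc (v _), ← (commute_t_xProd S).eq,
        ← mul_assoc, ← (hv _).eq]
    rw [Finset.sum_congr rfl this, Finset.sum_const, nsmul_eq_mul]
    simp only [← mul_assoc]
    rw [(Nat.cast_commute _ t).eq]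
  have exch3 : ∀ S ∈ A.powerset, ∑ W ∈ (A \ S).powerset,
      ∑ i ∈ (A \ S) \ W, v ((A \ S) \ W).card * xProd S * (Q W * br i a) =
      ∑ W ∈ (A \ S).powerset, v (((A \ S) \ W).card + 1) * xProd S * (Q W - G W) := by
    intro S hS
    -- The coefficient is expressed through `R \ {i}`, the third block once `i` has moved to `W`;
    -- this is the source of the shift `|R| + 1`.
    have e : ∀ W, ∀ i ∈ (A \ S) \ W, v ((A \ S) \ W).card * xProd S * (Q W * br i a) =
        v ((((A \ S) \ W).erase i).card + 1) * xProd S * (Q W * br i a) := by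
      intro W i hi
      rw [Finset.card_erase_add_one hi]
    rw [Finset.sum_congr rfl fun W _ => Finset.sum_congr rfl (e W),
      ← sum_powerset_exchange (A \ S) (fun i W R =>
        v (R.card + 1) * xProd S * (Q W * br i a))]
    refine Finset.sum_congr rfl fun W hW => ?_
    rw [Finset.mem_powerset] at hW
    have hWA : ∀ i ∈ W, i ∈ A := fun i hi => (Finset.mem_sdiff.mp (hW hi)).1
    have m := brListSum_cons_right haC (fun h => haA (hWA a h)) fun i hi => hAC i (hWA i hi)
    rw [← hQ, ← hG] at m
    rw [m, add_sub_cancel_left, Finset.mul_sum]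
  have lhs : partitionSum v A (a :: C) * (x a + ((C.map (br a)).sum - ∑ i ∈ A, br i a)) =
      ∑ S ∈ A.powerset, ∑ W ∈ (A \ S).powerset,
        (v ((A \ S) \ W).card * xProd S * (x a * G W)
          + v ((A \ S) \ W).card * xProd S * G (insert a W)
          - t * ((((A \ S) \ W).card : FKAlg n) * v (((A \ S) \ W).card - 1)) * xProd S * Q W
          - v (((A \ S) \ W).card + 1) * xProd S * (Q W - G W)) := by
    simp only [partitionSum, Finset.sum_mul]
    rw [Finset.sum_congr rfl fun S hS => Finset.sum_congr rfl (term S hS)]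
    simp only [Finset.sum_add_distrib, Finset.sum_sub_distrib]
    rw [exch1, Finset.sum_congr rfl fun S _ => exch2 S, Finset.sum_congr rfl exch3]
    simp only [Finset.sum_sub_distrib, mul_sub]
    abel
  rw [lhs, partitionSum_insert_eq v haA, partitionSum, ← Finset.sum_add_distrib]
  refine Finset.sum_congr rfl fun S _ => ?_
  rw [← Finset.sum_add_distrib]
  refine Finset.sum_congr rfl fun W _ => ?_
  rw [← hQ, ← hG, huv]
  simp only [mul_sub, sub_mul]
  abel

/-! ### Recursion for the elementary symmetric polynomials. -/

theorem esymmDunkl_zero (A : Finset (Fin n)) : esymmDunkl 0 A = 1 := by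
  rw [esymmDunkl, Finset.powersetCard_zero, Finset.sum_singleton]
  exact Finset.noncommProd_empty _ _

theorem esymmDunkl_eq_zero {k : ℕ} {A : Finset (Fin n)} (h : A.card < k) : esymmDunkl k A = 0 := by
  rw [esymmDunkl, Finset.powersetCard_eq_empty.mpr h, Finset.sum_empty]

theorem esymmDunkl_insert (k : ℕ) {A : Finset (Fin n)} {a : Fin n} (ha : a ∉ A) :
    esymmDunkl (k + 1) (insert a A) = esymmDunkl (k + 1) A + esymmDunkl k A * dunkl a := by
  have haT : ∀ T ∈ A.powersetCard k, a ∉ T := fun T hT h =>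
    ha ((Finset.mem_powersetCard.mp hT).1 h)
  rw [esymmDunkl, Finset.powersetCard_succ_insert ha, Finset.sum_union, Finset.sum_image]
  · rw [esymmDunkl, esymmDunkl, Finset.sum_mul]
    congr 1
    exact Finset.sum_congr rfl fun T hT =>
      Finset.noncommProd_insert_of_notMem' T a dunkl _ (haT T hT)
  · intro S hS T hT h
    rw [← Finset.erase_insert (haT S hS), ← Finset.erase_insert (haT T hT)]
    exact congrArg (fun U => Finset.erase U a) h
  · rw [Finset.disjoint_left]
    intro T hT hT'
    obtain ⟨U, _, rfl⟩ := Finset.mem_image.mp hT'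
    exact ha ((Finset.mem_powersetCard.mp hT).1 (Finset.mem_insert_self a U))

/-! ### The coefficients and their matching recurrence. -/

theorem pieriN_zero_right (q : ℕ) : pieriN q 0 = 1 := by
  simp [pieriN]

theorem pieriN_zero_succ (s : ℕ) : pieriN 0 (s + 1) = (2 * s + 1) * pieriN 0 s := by
  have h : 2 * (s + 1) - 1 = 2 * s + 1 := by omega
  simp only [pieriN, zero_add, Nat.choose_self, mul_one, h, Nat.doubleFactorial_add_one]

theorem pieriN_succ_succ (q s : ℕ) :
    pieriN (q + 1) (s + 1) = pieriN q (s + 1) + (q + 2 * s + 2) * pieriN (q + 1) s := by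
  have h : 2 * (s + 1) - 1 = 2 * s + 1 := by omega
  -- Pascal's rule gives the two summands; this absorption identity trades the factor `2s + 1` of
  -- the double factorial for `q + 2s + 2`.
  have h1 := Nat.add_one_mul_choose_eq (q + 2 * s + 1) (2 * s)
  have e1 : q + 1 + 2 * (s + 1) = q + 2 * s + 2 + 1 := by ring
  have e2 : 2 * (s + 1) = 2 * s + 1 + 1 := by ring
  have e3 : q + 1 + 2 * s = q + 2 * s + 1 := by ring
  have e4 : q + (2 * s + 1 + 1) = q + 2 * s + 2 := by ring
  simp only [pieriN, h, e1, Nat.doubleFactorial_add_one]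
  rw [e2, Nat.choose_succ_succ', e3, e4]
  linear_combination (2 * s - 1).doubleFactorial * h1.symm

/-- The coefficient `(-t)^r N(q, 2r)` if `F = q + 2r`, and `0` if `F` is not of this form. -/
noncomputable def pieriCoeff (q F : ℕ) : FKAlg n :=
  ∑ r ∈ Finset.range (F + 1), if F = q + 2 * r then (-t) ^ r * (pieriN q r : FKAlg n) else 0

theorem pieriCoeff_add (q r : ℕ) :
    (pieriCoeff q (q + 2 * r) : FKAlg n) = (-t) ^ r * (pieriN q r : FKAlg n) := by
  rw [pieriCoeff, Finset.sum_eq_single r]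
  · simp
  · intro s _ hs
    rw [if_neg (by omega)]
  · intro h
    rw [Finset.mem_range] at h
    omega

theorem pieriCoeff_eq_zero {q F : ℕ} (h : ∀ r, F ≠ q + 2 * r) : (pieriCoeff q F : FKAlg n) = 0 :=
  Finset.sum_eq_zero fun r _ => if_neg (h r)

theorem commute_t_pieriCoeff (q F : ℕ) : Commute (t : FKAlg n) (pieriCoeff q F) := by
  refine Commute.sum_right _ _ _ fun r _ => ?_
  split_ifs
  · exact ((Commute.refl t).neg_right.pow_right r).mul_right (Nat.cast_commute _ t).symm
  · exact Commute.zero_right t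

theorem pieriCoeff_zero_succ (F : ℕ) :
    (pieriCoeff 0 (F + 1) : FKAlg n) = 0 - t * ((F : FKAlg n) * pieriCoeff 0 (F - 1)) := by
  by_cases h : ∃ s, F = 2 * s + 1
  · obtain ⟨s, rfl⟩ := h
    have e1 : 2 * s + 1 + 1 = 0 + 2 * (s + 1) := by ring
    have e2 : 2 * s + 1 - 1 = 0 + 2 * s := by omega
    rw [e1, e2, pieriCoeff_add, pieriCoeff_add, pieriN_zero_succ, Nat.cast_mul, pow_succ',
      (Nat.cast_commute (2 * s + 1) (pieriN 0 s : FKAlg n)).eq,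
      (Nat.cast_commute (2 * s + 1) ((-t) ^ s * (pieriN 0 s : FKAlg n))).eq]
    simp only [neg_mul, mul_assoc, zero_sub]
  · have h1 : (pieriCoeff 0 (F + 1) : FKAlg n) = 0 :=
      pieriCoeff_eq_zero fun r hr => h ⟨r - 1, by omega⟩
    have h2 : (F : FKAlg n) * pieriCoeff 0 (F - 1) = 0 := by
      obtain rfl | hF := Nat.eq_zero_or_pos F
      · simp
      · rw [pieriCoeff_eq_zero fun r hr => h ⟨r, by omega⟩, mul_zero]
    rw [h1, h2, mul_zero, sub_zero]

theorem pieriCoeff_succ_succ (q F : ℕ) :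
    (pieriCoeff (q + 1) (F + 1) : FKAlg n) =
      pieriCoeff q F - t * ((F : FKAlg n) * pieriCoeff (q + 1) (F - 1)) := by
  by_cases h : ∃ r, F = q + 2 * r
  · obtain ⟨r, rfl⟩ := h
    have e1 : q + 2 * r + 1 = q + 1 + 2 * r := by ring
    rw [e1, pieriCoeff_add, pieriCoeff_add]
    cases r with
    | zero =>
      -- The second argument is below `q + 1`, even when the subtraction truncates at `q = 0`.
      have h2 : ((q + 2 * 0 : ℕ) : FKAlg n) * pieriCoeff (q + 1) (q + 2 * 0 - 1) = 0 := by
        rw [pieriCoeff_eq_zero (by omega), mul_zero]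
      rw [h2]
      simp [pieriN_zero_right]
    | succ s =>
      have e2 : q + 2 * (s + 1) - 1 = q + 1 + 2 * s := by omega
      have e3 : q + 2 * (s + 1) = q + 2 * s + 2 := by ring
      rw [e2, pieriCoeff_add, pieriN_succ_succ, e3, Nat.cast_add, Nat.cast_mul, mul_add,
        sub_eq_add_neg]
      congr 1
      rw [pow_succ', (Nat.cast_commute (q + 2 * s + 2) (pieriN (q + 1) s : FKAlg n)).eq,
        (Nat.cast_commute (q + 2 * s + 2) ((-t) ^ s * (pieriN (q + 1) s : FKAlg n))).eq]
      simp only [neg_mul, mul_assoc]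
  · have h1 : (pieriCoeff (q + 1) (F + 1) : FKAlg n) = 0 :=
      pieriCoeff_eq_zero fun r hr => h ⟨r, by omega⟩
    have h2 : (F : FKAlg n) * pieriCoeff (q + 1) (F - 1) = 0 := by
      obtain rfl | hF := Nat.eq_zero_or_pos F
      · simp
      · rw [pieriCoeff_eq_zero fun r hr => h ⟨r + 1, by omega⟩, mul_zero]
    rw [h1, h2, pieriCoeff_eq_zero fun r hr => h ⟨r, hr⟩, mul_zero, sub_zero]

/-! ### The index set `{1, …, m}`, its complementary list, and the induction on `m`. -/

theorem mem_drop_finRange {q : ℕ} {i : Fin n} : i ∈ (List.finRange n).drop q ↔ q ≤ i := by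
  rw [List.mem_drop_iff_getElem]
  constructor
  · rintro ⟨j, hj, rfl⟩
    simp
  · intro h
    refine ⟨i - q, ?_, ?_⟩
    · simp only [List.length_finRange]
      omega
    · ext
      simp only [List.getElem_finRange, Fin.val_cast]
      omega

theorem nodup_drop_finRange (q : ℕ) : ((List.finRange n).drop q).Nodup :=
  (List.nodup_finRange n).sublist (List.drop_sublist q _)

theorem drop_finRange_eq_cons {q : ℕ} (hq : q < n) :
    (List.finRange n).drop q = ⟨q, hq⟩ :: (List.finRange n).drop (q + 1) := by
  rw [List.drop_eq_getElem_cons (by simpa using hq)]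
  simp

theorem mem_initial {m : ℕ} {i : Fin n} : i ∈ initial n m ↔ (i : ℕ) < m := by
  simp [initial]

theorem card_initial {m : ℕ} (hm : m ≤ n) : (initial n m).card = m := by
  rw [initial, Fin.card_filter_val_lt]
  omega

theorem initial_succ {m : ℕ} (hm : m < n) : initial n (m + 1) = insert ⟨m, hm⟩ (initial n m) := by
  ext i
  simp only [mem_initial, Finset.mem_insert, Fin.ext_iff]
  omega

theorem dunkl_eq {m : ℕ} (hm : m < n) :
    dunkl (⟨m, hm⟩ : Fin n) = x ⟨m, hm⟩ + ((((List.finRange n).drop (m + 1)).map (br ⟨m, hm⟩)).sum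
      - ∑ i ∈ initial n m, br i ⟨m, hm⟩) := by
  have hsplit : Finset.univ.erase (⟨m, hm⟩ : Fin n) =
      ((List.finRange n).drop (m + 1)).toFinset ∪ initial n m := by
    ext i
    simp only [Finset.mem_erase, Finset.mem_univ, and_true, Finset.mem_union, List.mem_toFinset,
      mem_drop_finRange, mem_initial, ne_eq, Fin.ext_iff]
    omega
  rw [dunkl, hsplit, Finset.sum_union, List.sum_toFinset _ (nodup_drop_finRange _), sub_eq_add_neg,
    ← Finset.sum_neg_distrib]
  · congr 2
    refine Finset.sum_congr rfl fun i hi => br_antisymm _ _ ?_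
    rintro rfl
    exact absurd (mem_initial.mp hi) (lt_irrefl m)
  · rw [Finset.disjoint_left]
    intro i hi hi'
    rw [List.mem_toFinset, mem_drop_finRange] at hi
    rw [mem_initial] at hi'
    omega

theorem partitionSum_zero (A : Finset (Fin n)) (C : List (Fin n)) :
    partitionSum (fun _ => 0) A C = 0 := by
  simp [partitionSum]

theorem partitionSum_pieriCoeff_eq_zero {q : ℕ} {A : Finset (Fin n)} (h : A.card < q)
    (C : List (Fin n)) : partitionSum (pieriCoeff q) A C = 0 := by
  refine Finset.sum_eq_zero fun S _ => Finset.sum_eq_zero fun W _ => ?_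
  have : ((A \ S) \ W).card ≤ A.card :=
    Finset.card_le_card (Finset.sdiff_subset.trans Finset.sdiff_subset)
  rw [pieriCoeff_eq_zero (by omega), zero_mul, zero_mul]

theorem esymmDunkl_eq_partitionSum {m : ℕ} (hm : m ≤ n) (k q : ℕ) (hkq : k + q = m) :
    (esymmDunkl k (initial n m) : FKAlg n) =
      partitionSum (pieriCoeff q) (initial n m) ((List.finRange n).drop m) := by
  induction m generalizing k q with
  | zero =>
    obtain rfl : k = 0 := by omega
    obtain rfl : q = 0 := by omega
    have h0 : initial n 0 = ∅ := by simp [initial]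
    have h1 : (pieriCoeff 0 0 : FKAlg n) = 1 := by
      simpa [pieriN_zero_right] using pieriCoeff_add (n := n) 0 0
    simp [esymmDunkl_zero, h0, partitionSum, brListSum_empty, h1, xProd_empty]
  | succ m ih =>
    have hmn : m < n := hm
    have haA : (⟨m, hmn⟩ : Fin n) ∉ initial n m := by simp [mem_initial]
    have step : ∀ u : ℕ → FKAlg n,
        (∀ r, pieriCoeff q (r + 1) = u r - t * ((r : FKAlg n) * pieriCoeff q (r - 1))) →
        partitionSum (pieriCoeff q) (initial n (m + 1)) ((List.finRange n).drop (m + 1)) =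
          partitionSum u (initial n m) ((List.finRange n).drop m) +
          partitionSum (pieriCoeff q) (initial n m) ((List.finRange n).drop m) *
            dunkl ⟨m, hmn⟩ := by
      intro u hu
      rw [initial_succ hmn, drop_finRange_eq_cons hmn, dunkl_eq hmn]
      refine (partitionSum_mul_dunkl u (pieriCoeff q) haA ?_ (nodup_drop_finRange _) ?_
        (commute_t_pieriCoeff q) hu).symm
      · simp [mem_drop_finRange]
      · intro i hi
        rw [mem_initial] at hi
        rw [mem_drop_finRange]
        omega
    -- For `q = 0` the term `e_{m+1}` of only `m` Dunkl elements is zero, so `u = 0`; otherwise `u`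
    -- is the coefficient sequence for `q - 1`.
    cases q with
    | zero =>
      obtain rfl : k = m + 1 := by omega
      rw [step (fun _ => 0) pieriCoeff_zero_succ, partitionSum_zero, initial_succ hmn,
        esymmDunkl_insert m haA, ih (by omega) m 0 rfl,
        esymmDunkl_eq_zero (by rw [card_initial hmn.le]; omega)]
    | succ q =>
      rw [step (pieriCoeff q) (pieriCoeff_succ_succ q)]
      cases k with
      | zero =>
        -- For `k = 0` there is no product term: the required `|R| ≥ q + 1` exceeds the size of the
        -- set.
        have hzero : partitionSum (pieriCoeff (q + 1)) (initial n m)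
            ((List.finRange n).drop m) = 0 :=
          partitionSum_pieriCoeff_eq_zero (by rw [card_initial hmn.le]; omega) _
        rw [esymmDunkl_zero, hzero, zero_mul, add_zero, ← ih (by omega) 0 q (by omega),
          esymmDunkl_zero]
      | succ k =>
        rw [initial_succ hmn, esymmDunkl_insert k haA, ih (by omega) (k + 1) q (by omega),
          ih (by omega) k (q + 1) (by omega)]

/-! ### From bracket sums back to pairs of sequences. -/

theorem sum_powersetCard_sum_mem (l : ℕ) (D : Finset (Fin n))
    (f : Fin n → Finset (Fin n) → FKAlg n) :
    ∑ U ∈ D.powersetCard (l + 1), ∑ i ∈ U, f i (U.erase i) =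
      ∑ i ∈ D, ∑ U ∈ (D.erase i).powersetCard l, f i U := by
  simp only [Finset.powersetCard_eq_filter, Finset.sum_filter]
  rw [← sum_powerset_sum_mem D (fun i U _ => if U.card = l then f i U else 0)]
  refine Finset.sum_congr rfl fun U _ => ?_
  by_cases hU : U.card = l + 1
  · rw [if_pos hU]
    refine Finset.sum_congr rfl fun i hi => ?_
    rw [Finset.card_erase_of_mem hi, hU, if_pos (by omega)]
  · rw [if_neg hU]
    refine (Finset.sum_eq_zero fun i hi => if_neg ?_).symm
    have := Finset.card_erase_add_one hi
    omega

/-- Iterating `brListSum_cons_left` isolates the first bracket `[i,j]`. The remaining list still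
starts at `j`, since the second indices increase only weakly. -/
theorem brListSum_drop_finRange (q : ℕ) {U : Finset (Fin n)} (hU : U ≠ ∅) :
    brListSum ((List.finRange n).drop q) U =
      ∑ j ∈ Finset.univ.filter (fun j : Fin n => q ≤ j), ∑ i ∈ U,
        br i j * brListSum ((List.finRange n).drop j) (U.erase i) := by
  induction hd : n - q generalizing q with
  | zero =>
    rw [List.drop_of_length_le (by simp; omega), brListSum, if_neg hU, Finset.filter_false_of_mem,
      Finset.sum_empty]
    intro j _
    omega
  | succ d ih =>
    have hq : q < n := by omega
    have hfil : Finset.univ.filter (fun j : Fin n => q ≤ j) =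
        insert ⟨q, hq⟩ (Finset.univ.filter (fun j : Fin n => q + 1 ≤ j)) := by
      ext j
      simp only [Finset.mem_filter, Finset.mem_univ, true_and, Finset.mem_insert, Fin.ext_iff]
      omega
    rw [hfil, Finset.sum_insert (by simp), ← ih (q + 1) (by omega)]
    simp only [drop_finRange_eq_cons hq]
    rw [brListSum_cons_left, add_comm]

theorem monotone_finCons {l : ℕ} {j : Fin n} {f : Fin l → Fin n} :
    Monotone (Fin.cons j f : Fin (l + 1) → Fin n) ↔ (∀ a, j ≤ f a) ∧ Monotone f := by
  constructor
  · intro h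
    refine ⟨fun a => ?_, fun a b hab => ?_⟩
    · simpa using h (Fin.zero_le a.succ)
    · simpa using h (Fin.succ_le_succ_iff.mpr hab)
  · rintro ⟨h1, h2⟩ a b hab
    induction a using Fin.cases with
    | zero =>
      induction b using Fin.cases with
      | zero => exact le_rfl
      | succ b => simpa using h1 b
    | succ a =>
      induction b using Fin.cases with
      | zero => exact absurd hab (not_le.mpr (Fin.succ_pos a))
      | succ b => simpa using h2 (Fin.succ_le_succ_iff.mp hab)

open Classical in
/-- The pairs of sequences `(i₁, …, iₗ)`, `(j₁, …, jₗ)` with distinct `iₐ ∈ D` and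
`q ≤ j₁ ≤ ⋯ ≤ jₗ`. -/
noncomputable def seqPairs (l : ℕ) (D : Finset (Fin n)) (q : ℕ) :
    Finset ((Fin l → Fin n) × (Fin l → Fin n)) :=
  Finset.univ.filter fun p =>
    Function.Injective p.1 ∧ (∀ a, p.1 a ∈ D) ∧ (∀ a, q ≤ p.2 a) ∧ Monotone p.2

theorem mem_seqPairs {l : ℕ} {D : Finset (Fin n)} {q : ℕ}
    {p : (Fin l → Fin n) × (Fin l → Fin n)} :
    p ∈ seqPairs l D q ↔
      Function.Injective p.1 ∧ (∀ a, p.1 a ∈ D) ∧ (∀ a, q ≤ p.2 a) ∧ Monotone p.2 := by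
  simp [seqPairs]

theorem cons_mem_seqPairs {l : ℕ} {D : Finset (Fin n)} {q : ℕ} {i j : Fin n}
    {f g : Fin l → Fin n} :
    ((Fin.cons i f, Fin.cons j g) : (Fin (l + 1) → Fin n) × (Fin (l + 1) → Fin n)) ∈
      seqPairs (l + 1) D q ↔ (q ≤ j ∧ i ∈ D) ∧ (f, g) ∈ seqPairs l (D.erase i) j := by
  simp only [mem_seqPairs, Fin.cons_injective_iff, monotone_finCons, Fin.forall_fin_succ,
    Fin.cons_zero, Fin.cons_succ, Finset.mem_erase, Set.mem_range, not_exists, Fin.le_def]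
  constructor
  · rintro ⟨⟨h1, h2⟩, ⟨h3, h4⟩, ⟨h5, h6⟩, h7, h8⟩
    exact ⟨⟨h5, h3⟩, h2, fun a => ⟨h1 a, h4 a⟩, h7, h8⟩
  · rintro ⟨⟨h5, h3⟩, h2, h4, h7, h8⟩
    exact ⟨⟨fun a => (h4 a).1, h2⟩, ⟨h3, fun a => (h4 a).2⟩, ⟨h5, fun a => h5.trans (h7 a)⟩,
      h7, h8⟩

theorem sum_seqPairs (l : ℕ) (D : Finset (Fin n)) (q : ℕ) :
    ∑ p ∈ seqPairs l D q, (List.ofFn fun a : Fin l => br (p.1 a) (p.2 a)).prod =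
      ∑ U ∈ D.powersetCard l, brListSum ((List.finRange n).drop q) U := by
  induction l generalizing D q with
  | zero =>
    have : seqPairs 0 D q = Finset.univ := by
      ext p
      simp [mem_seqPairs, Function.injective_of_subsingleton, Subsingleton.monotone]
    rw [this]
    simp [brListSum_empty]
  | succ l ih =>
    have hr : ∑ U ∈ D.powersetCard (l + 1), brListSum ((List.finRange n).drop q) U =
        ∑ j ∈ Finset.univ.filter (fun j : Fin n => q ≤ j), ∑ i ∈ D,
          ∑ p ∈ seqPairs l (D.erase i) j,
            br i j * (List.ofFn fun a : Fin l => br (p.1 a) (p.2 a)).prod := by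
      have hU : ∀ U ∈ D.powersetCard (l + 1), U ≠ ∅ := by
        rintro U hU rfl
        simp [Finset.mem_powersetCard] at hU
      rw [Finset.sum_congr rfl fun U h => brListSum_drop_finRange q (hU U h), Finset.sum_comm]
      refine Finset.sum_congr rfl fun j _ => ?_
      rw [sum_powersetCard_sum_mem l D
        (fun i U => br i j * brListSum ((List.finRange n).drop j) U)]
      refine Finset.sum_congr rfl fun i _ => ?_
      rw [← Finset.mul_sum, ← Finset.mul_sum, ih]
    rw [hr, ← Finset.sum_product', Finset.sum_sigma']
    symm
    refine Finset.sum_bij' (fun s _ => (Fin.cons s.1.2 s.2.1, Fin.cons s.1.1 s.2.2))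
      (fun p _ => ⟨(p.2 0, p.1 0), (Fin.tail p.1, Fin.tail p.2)⟩) ?_ ?_ ?_ ?_ ?_
    · rintro ⟨⟨j, i⟩, ⟨f, g⟩⟩ h
      rw [cons_mem_seqPairs]
      simpa using h
    · rintro ⟨f, g⟩ h
      rw [← Fin.cons_self_tail f, ← Fin.cons_self_tail g, cons_mem_seqPairs] at h
      simpa using h
    · rintro ⟨⟨j, i⟩, ⟨f, g⟩⟩ h
      simp
    · rintro ⟨f, g⟩ h
      simp
    · rintro ⟨⟨j, i⟩, ⟨f, g⟩⟩ h
      simp [List.ofFn_succ]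

theorem pieriIndex_eq (m l : ℕ) (S : Finset (Fin n)) :
    pieriIndex n m l S = seqPairs l (initial n m \ S) m := by
  simp [pieriIndex, seqPairs, mem_initial]

theorem pieriSum_eq (m k r : ℕ) :
    pieriSum n m k r = ∑ S ∈ (initial n m).powerset, ∑ W ∈ (initial n m \ S).powerset,
      if W.card + S.card + 2 * r = k then
        xProd S * brListSum ((List.finRange n).drop m) W else 0 := by
  rw [pieriSum]
  refine Finset.sum_congr rfl fun S _ => ?_
  rw [Finset.sum_filter]
  have : ∀ l ∈ Finset.range (k + 1), (if l + S.card + 2 * r = k then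
      ∑ p ∈ pieriIndex n m l S, xProd S * (List.ofFn fun a : Fin l => br (p.1 a) (p.2 a)).prod
      else 0) = ∑ W ∈ (initial n m \ S).powerset, if W.card = l then
        (if W.card + S.card + 2 * r = k then
          xProd S * brListSum ((List.finRange n).drop m) W else 0) else 0 := by
    intro l _
    rw [← Finset.mul_sum, pieriIndex_eq, sum_seqPairs, ← Finset.sum_filter,
      ← Finset.powersetCard_eq_filter]
    by_cases h : l + S.card + 2 * r = k
    · rw [if_pos h, Finset.mul_sum]
      refine Finset.sum_congr rfl fun W hW => ?_
      rw [(Finset.mem_powersetCard.mp hW).2, if_pos h]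
    · rw [if_neg h]
      refine (Finset.sum_eq_zero fun W hW => ?_).symm
      rw [(Finset.mem_powersetCard.mp hW).2, if_neg h]
  rw [Finset.sum_congr rfl this, Finset.sum_comm]
  refine Finset.sum_congr rfl fun W _ => ?_
  rw [Finset.sum_ite_eq]
  split_ifs with h1 h2 h2
  · rfl
  · rfl
  · rw [Finset.mem_range] at h1
    omega
  · rfl

/-- As `|R| + |W| + |S| = k + q`, the condition `|W| + |S| + 2r = k` says `|R| = q + 2r`; each
partition therefore contributes for at most one `r`. -/
theorem partitionSum_eq_sum_pieriSum {m k q : ℕ} (hm : m ≤ n) (hkq : k + q = m) :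
    partitionSum (pieriCoeff q) (initial n m) ((List.finRange n).drop m) =
      ∑ r ∈ Finset.range (k + 1),
        (-(t : FKAlg n)) ^ r * (pieriN q r : FKAlg n) * pieriSum n m k r := by
  simp only [pieriSum_eq, Finset.mul_sum]
  rw [Finset.sum_comm, partitionSum]
  refine Finset.sum_congr rfl fun S hS => ?_
  rw [Finset.sum_comm]
  refine Finset.sum_congr rfl fun W hW => ?_
  rw [Finset.mem_powerset] at hS hW
  have hcard : ((initial n m \ S) \ W).card + W.card + S.card = m := by
    have h1 := Finset.card_sdiff_add_card_eq_card hS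
    have h2 := Finset.card_sdiff_add_card_eq_card hW
    rw [card_initial hm] at h1
    omega
  by_cases h : ∃ r, ((initial n m \ S) \ W).card = q + 2 * r
  · obtain ⟨r, hr⟩ := h
    rw [hr, pieriCoeff_add, Finset.sum_eq_single_of_mem r (by rw [Finset.mem_range]; omega),
      if_pos (by omega), mul_assoc]
    intro s _ hs
    rw [if_neg (by omega), mul_zero]
  · rw [pieriCoeff_eq_zero (fun r hr => h ⟨r, hr⟩), zero_mul, zero_mul]
    refine (Finset.sum_eq_zero fun r _ => ?_).symm
    rw [if_neg (fun hk => h ⟨r, by omega⟩), mul_zero]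

end FKAlg

theorem theorem2p1 (n m k : ℕ) (hkm : k ≤ m) (hmn : m ≤ n) :
    FKAlg.esymmDunkl k (FKAlg.initial n m) =
      ∑ r ∈ Finset.range (k + 1),
        (-(FKAlg.t : FKAlg n)) ^ r * (FKAlg.pieriN (m - k) r : FKAlg n) *
          FKAlg.pieriSum n m k r := by
  have hkq : k + (m - k) = m := by omega
  rw [FKAlg.esymmDunkl_eq_partitionSum hmn k (m - k) hkq,
    FKAlg.partitionSum_eq_sum_pieriSum hmn hkq]
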